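/- Let $n\ge 1$ and let $(M,\omega)$ be a nonempty compact real-analytic manifold of dimension $2n$ with a real-analytic symplectic form. For $f\in C^\omega(M)$ let $X_f$ be the Hamiltonian vector field, $\omega(X_f,\cdot)=df$. Let $H_1,\dots,H_n\in C^\omega(M)$ be real-valued functions with $\{H_j,H_k\}=\omega(X_{H_j},X_{H_k})=0$ for all $j,k$ and $dH_1\wedge\cdots\wedge dH_n\neq 0$ at every point of an open dense subset of $M$. Let $\mathcal P$ be the associated singular real polarization, i.e. the (singular) complex distribution generated pointwise by the Hamiltonian vector fields, $\mathcal P_x=\mathrm{span}_{\mathbb C}\{X_{H_1}(x),\dots,X_{H_n}(x)\}\subset T_xM\otimes\mathbb C$. For $h\in C^\omega(M)$ and $\tau\in\mathbb C$ let $e^{\tau\mathcal L_{X_h}}\mathcal P$ be the complex distribution whose fibre at $x$ consists of the values at $x$ of all $e^{\tau\mathcal L_{X_h}}Y=\sum_{k\ge0}\frac{\tau^k}{k!}\mathcal L_{X_h}^kY$, where $Y$ is a real-analytic complex vector field defined near $x$ with values in $\mathcal P$ for which this series converges absolutely at every point near $x$ to a real-analytic complex vector field. A complex distribution $\mathcal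 Q\subset TM\otimes\mathbb C$ is called a Kähler polarization if it is smooth, involutive and Lagrangian and $i\,\omega(v,\bar v)>0$ for all nonzero $v\in\mathcal Q$. Then $\mathcal P$ has no real-analytic regulator of the first type (Thiemann complexifier): there is no real-valued $h\in C^\omega(M)$ for which there exists $T>0$ such that $e^{it\mathcal L_{X_h}}\mathcal P$ is a Kähler polarization for all $t\in(0,T)$. -/

import Mathlib

open scoped Manifold ContDiff Topology TensorProduct Bundle
open VectorField

namespace KahlerRegularization

noncomputable section

section

variable {E : Type*} [NormedAddCommGroup E] [NormedSpace ℝ E]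
variable {M : Type*} [TopologicalSpace M] [ChartedSpace E M]

/-- The vector field `X` is of class `C^r` at the point `x` (for `r = ω`: real analytic on a
neighbourhood of `x`). -/
def VFContDiffAt [IsManifold 𝓘(ℝ, E) 1 M] (r : WithTop ℕ∞)
    (X : ∀ x : M, TangentSpace 𝓘(ℝ, E) x) (x : M) : Prop :=
  ContMDiffAt 𝓘(ℝ, E) 𝓘(ℝ, E).tangent r
    (fun y => (⟨y, X y⟩ : TangentBundle 𝓘(ℝ, E) M)) x

variable (E M) in
/-- A real-analytic symplectic form on the real-analytic manifold `M`. -/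
structure AnalyticSymplecticForm [IsManifold 𝓘(ℝ, E) ω M] where
  /-- the value of the form at a point, as a bilinear form on the tangent space -/
  form (x : M) : TangentSpace 𝓘(ℝ, E) x →L[ℝ] TangentSpace 𝓘(ℝ, E) x →L[ℝ] ℝ
  analytic : ContMDiff 𝓘(ℝ, E) (𝓘(ℝ, E).prod 𝓘(ℝ, E →L[ℝ] E →L[ℝ] ℝ)) ω
    (fun x => Bundle.TotalSpace.mk' (E →L[ℝ] E →L[ℝ] ℝ)
      (E := fun x : M => TangentSpace 𝓘(ℝ, E) x →L[ℝ] TangentSpace 𝓘(ℝ, E) x →L[ℝ] ℝ)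
      x (form x))
  alternating (x : M) (v : TangentSpace 𝓘(ℝ, E) x) : form x v v = 0
  nondegenerate (x : M) (v : TangentSpace 𝓘(ℝ, E) x) (hv : ∀ w, form x v w = 0) : v = 0
  /-- The exterior derivative vanishes: its invariant expression is zero on any three vector
  fields that are smooth near the point. -/
  closed (x : M) (X Y Z : ∀ y : M, TangentSpace 𝓘(ℝ, E) y)
    (hX : VFContDiffAt ∞ X x) (hY : VFContDiffAt ∞ Y x) (hZ : VFContDiffAt ∞ Z x) :
    mvfderiv 𝓘(ℝ, E) (fun y => form y (Y y) (Z y)) x (X x)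
      - mvfderiv 𝓘(ℝ, E) (fun y => form y (X y) (Z y)) x (Y x)
      + mvfderiv 𝓘(ℝ, E) (fun y => form y (X y) (Y y)) x (Z x)
      - form x (mlieBracket 𝓘(ℝ, E) X Y x) (Z x)
      + form x (mlieBracket 𝓘(ℝ, E) X Z x) (Y x)
      - form x (mlieBracket 𝓘(ℝ, E) Y Z x) (X x) = 0

/-! ### Complexified tangent spaces and complex vector fields -/

/-- The complexified tangent space `T_x M ⊗ ℂ`. -/
abbrev CTangent (x : M) : Type _ := ℂ ⊗[ℝ] (TangentSpace 𝓘(ℝ, E) x)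

/-- The complex tangent vector `a + i b`. -/
def toCTangent {x : M} (a b : TangentSpace 𝓘(ℝ, E) x) : CTangent (E := E) x :=
  (1 : ℂ) ⊗ₜ[ℝ] a + Complex.I ⊗ₜ[ℝ] b

/-- Complex conjugation on `T_x M ⊗ ℂ`. -/
def conjC (x : M) : CTangent (E := E) x →ₗ[ℝ] CTangent (E := E) x :=
  LinearMap.rTensor (TangentSpace 𝓘(ℝ, E) x) Complex.conjAe.toLinearMap

variable (E M) in
/-- A (not necessarily continuous) complex vector field `re + i im`. -/
structure ComplexVectorField where
  /-- the real part -/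
  re (x : M) : TangentSpace 𝓘(ℝ, E) x
  /-- the imaginary part -/
  im (x : M) : TangentSpace 𝓘(ℝ, E) x

namespace ComplexVectorField

/-- The value at `x`, in `T_x M ⊗ ℂ`. -/
def val (Y : ComplexVectorField E M) (x : M) : CTangent (E := E) x :=
  toCTangent (Y.re x) (Y.im x)

/-- `Y` is of class `C^r` at `x` (for `r = ω`: real analytic near `x`). -/
def ContDiffAt [IsManifold 𝓘(ℝ, E) 1 M] (r : WithTop ℕ∞) (Y : ComplexVectorField E M) (x : M) :
    Prop :=
  VFContDiffAt r Y.re x ∧ VFContDiffAt r Y.im x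

/-- The complex bilinear extension of the Lie bracket of vector fields. -/
def bracket (Y Z : ComplexVectorField E M) : ComplexVectorField E M where
  re x := mlieBracket 𝓘(ℝ, E) Y.re Z.re x - mlieBracket 𝓘(ℝ, E) Y.im Z.im x
  im x := mlieBracket 𝓘(ℝ, E) Y.re Z.im x + mlieBracket 𝓘(ℝ, E) Y.im Z.re x

/-- The Lie derivative `L_X Y = [X, Y]` along a real vector field `X`. -/
def lieDeriv (X : ∀ x : M, TangentSpace 𝓘(ℝ, E) x) (Y : ComplexVectorField E M) :
    ComplexVectorField E M where
  re x := mlieBracket 𝓘(ℝ, E) X Y.re x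
  im x := mlieBracket 𝓘(ℝ, E) X Y.im x

/-- Multiplication by a complex number. -/
def smulC (c : ℂ) (Y : ComplexVectorField E M) : ComplexVectorField E M where
  re x := c.re • Y.re x - c.im • Y.im x
  im x := c.im • Y.re x + c.re • Y.im x

/-- `Z` is the sum at the point `x` of the Lie series
`e^{τ L_X} Y = ∑ₖ τᵏ / k! · (L_X)ᵏ Y` (real and imaginary parts converge absolutely). -/
def IsLieExpAt (X : ∀ x : M, TangentSpace 𝓘(ℝ, E) x) (τ : ℂ) (Y Z : ComplexVectorField E M)
    (x : M) : Prop :=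
  HasSum (fun k : ℕ => (smulC (τ ^ k / (k.factorial : ℂ)) ((lieDeriv X)^[k] Y)).re x) (Z.re x) ∧
  HasSum (fun k : ℕ => (smulC (τ ^ k / (k.factorial : ℂ)) ((lieDeriv X)^[k] Y)).im x) (Z.im x)

/-- `Y` is, near `x`, a section of the complex distribution `Q`. -/
def IsSectionNear (Q : ∀ x : M, Submodule ℂ (CTangent (E := E) x)) (Y : ComplexVectorField E M)
    (x : M) : Prop :=
  ∀ᶠ y in 𝓝 x, Y.val y ∈ Q y

end ComplexVectorField

/-- The image `e^{τ L_X} Q` of a (possibly singular) complex distribution `Q` under the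
complex-time flow of the real vector field `X`: at `x` it consists of the values at `x` of all
`e^{τ L_X} Y`, where `Y` is a real-analytic section of `Q` near `x` whose Lie series at
time `τ` converges near `x` to a real-analytic complex vector field. -/
def complexTimeImage [IsManifold 𝓘(ℝ, E) 1 M] (X : ∀ x : M, TangentSpace 𝓘(ℝ, E) x) (τ : ℂ)
    (Q : ∀ x : M, Submodule ℂ (CTangent (E := E) x)) (x : M) :
    Submodule ℂ (CTangent (E := E) x) :=
  Submodule.span ℂ {z | ∃ Y Z : ComplexVectorField E M,
    Y.ContDiffAt ω x ∧ Y.IsSectionNear Q x ∧ Z.ContDiffAt ω x ∧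
    (∀ᶠ y in 𝓝 x, ComplexVectorField.IsLieExpAt X τ Y Z y) ∧ Z.val x = z}

end

namespace AnalyticSymplecticForm

variable {E : Type*} [NormedAddCommGroup E] [NormedSpace ℝ E]
variable {M : Type*} [TopologicalSpace M] [ChartedSpace E M] [IsManifold 𝓘(ℝ, E) ω M]

/-- The symplectic form at `x` as an algebraic bilinear form. -/
def bilin (S : AnalyticSymplecticForm E M) (x : M) :
    LinearMap.BilinForm ℝ (TangentSpace 𝓘(ℝ, E) x) :=
  LinearMap.mk₂ ℝ (fun v w => S.form x v w) (by simp) (by simp) (by simp) (by simp)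

/-- The complex bilinear extension of the symplectic form to `T_x M ⊗ ℂ`. -/
def formC (S : AnalyticSymplecticForm E M) (x : M) :
    LinearMap.BilinForm ℂ (CTangent (E := E) x) :=
  LinearMap.BilinForm.baseChange ℂ (S.bilin x)

/-- A Kähler polarization of `(M, S)`: a smooth involutive Lagrangian complex distribution `Q`
with `i S(v, v̄) > 0` for all nonzero `v ∈ Q` (so that `Q ∩ Q̄ = 0`). These are exactly the
bundles `T^{0,1} = {u + i J u}` of the complex structures `J` for which `S(·, J ·)` is a
Kähler metric. -/
structure IsKahlerPolarization (S : AnalyticSymplecticForm E M)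
    (Q : ∀ x : M, Submodule ℂ (CTangent (E := E) x)) : Prop where
  lagrangian (x : M) (v : CTangent (E := E) x) : v ∈ Q x ↔ ∀ w ∈ Q x, S.formC x v w = 0
  smooth (x : M) (v : CTangent (E := E) x) (hv : v ∈ Q x) :
    ∃ Y : ComplexVectorField E M, Y.ContDiffAt ∞ x ∧ Y.IsSectionNear Q x ∧ Y.val x = v
  involutive (x : M) (Y Z : ComplexVectorField E M) (hY : Y.ContDiffAt ∞ x)
    (hZ : Z.ContDiffAt ∞ x) (hYQ : Y.IsSectionNear Q x) (hZQ : Z.IsSectionNear Q x) :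
    (Y.bracket Z).val x ∈ Q x
  positive (x : M) (v : CTangent (E := E) x) (hv : v ∈ Q x) (hv0 : v ≠ 0) :
    0 < (Complex.I * S.formC x v (conjC x v)).re

variable [FiniteDimensional ℝ E]

instance (x : M) : FiniteDimensional ℝ (TangentSpace 𝓘(ℝ, E) x) :=
  inferInstanceAs (FiniteDimensional ℝ E)

/-- The isomorphism `T_x M ≃ T_x^* M`, `v ↦ S(v, ·)`. -/
def flat (S : AnalyticSymplecticForm E M) (x : M) :
    TangentSpace 𝓘(ℝ, E) x ≃ₗ[ℝ] Module.Dual ℝ (TangentSpace 𝓘(ℝ, E) x) :=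
  LinearMap.linearEquivOfInjective (S.bilin x)
    ((injective_iff_map_eq_zero (S.bilin x)).2 fun v hv =>
      S.nondegenerate x v fun w => LinearMap.congr_fun hv w)
    Subspace.dual_finrank_eq.symm

/-- The Hamiltonian vector field `X_f`, given by `S(X_f, ·) = df`. -/
def hamVF (S : AnalyticSymplecticForm E M) (f : M → ℝ) (x : M) : TangentSpace 𝓘(ℝ, E) x :=
  (S.flat x).symm (mvfderiv 𝓘(ℝ, E) f x).toLinearMap

theorem form_hamVF (S : AnalyticSymplecticForm E M) (f : M → ℝ) (x : M)
    (v : TangentSpace 𝓘(ℝ, E) x) : S.form x (S.hamVF f x) v = mvfderiv 𝓘(ℝ, E) f x v :=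
  LinearMap.congr_fun
    ((S.flat x).apply_symm_apply (mvfderiv 𝓘(ℝ, E) f x).toLinearMap) v

/-- The Poisson bracket `{f, g} = S(X_f, X_g)`. -/
def poisson (S : AnalyticSymplecticForm E M) (f g : M → ℝ) (x : M) : ℝ :=
  S.form x (S.hamVF f x) (S.hamVF g x)

/-- The (singular) real polarization of the functions `H₁, …, Hₙ`: the complex distribution
generated pointwise by their Hamiltonian vector fields. -/
def realPolarization (S : AnalyticSymplecticForm E M) {n : ℕ} (H : Fin n → M → ℝ) (x : M) :
    Submodule ℂ (CTangent (E := E) x) :=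
  Submodule.span ℂ (Set.range fun j => toCTangent (S.hamVF (H j) x) 0)

/-- `h` is a regulator of the first type (Thiemann complexifier) of `Q`: for some `T > 0` the
distribution `e^{i t L_{X_h}} Q` is a Kähler polarization for all `t ∈ (0, T)`. -/
def IsRegulatorOfFirstType (S : AnalyticSymplecticForm E M)
    (Q : ∀ x : M, Submodule ℂ (CTangent (E := E) x)) (h : M → ℝ) : Prop :=
  ∃ T : ℝ, 0 < T ∧ ∀ t : ℝ, 0 < t → t < T →
    S.IsKahlerPolarization (complexTimeImage (S.hamVF h) (Complex.I * (t : ℂ)) Q)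

end AnalyticSymplecticForm

end

end KahlerRegularization

/-!
Since `M` is compact, `h` attains a maximum at some point `x`, where `X_h` vanishes. Hence `L_{X_h}`
acts on the values of vector fields at `x` by a linear map `A`, and every element of the fibre of
`e^{i t L_{X_h}} P` at `x` is `e^{i t A}` of an element of `P_x` (`complexTimeImage_le_map`). A
Lagrangian fibre has complex dimension `n`, while `P_x` is spanned by `n` vectors, so `P_x` has
dimension `n`, and the fibre at `x` is all of `e^{i t A} P_x` (`complexTimeImage_eq_map`).

Take a nonzero real vector `v = X_{H_j}(x)` of `P_x`. Positivity of the Kähler polarizations at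
`e^{i t A} v = a + i b` says `ω(a, b) > 0` for all small `t > 0`, and the derivative of `ω(a, b)` at
`t = 0` is `ω(v, A v)`, so `ω(v, A v) ≥ 0`. But `ω(v, A v)` is the Hessian of `h` at `x` applied to
`v`, which is negative semidefinite at a maximum (`exists_linearization_of_isLocalMax`). So `v` is in
the kernel of the Hessian, that is `A v = 0`; then `e^{i t A} v = v` is real, and `ω(v, v) = 0`
contradicts positivity.
-/

open scoped Manifold ContDiff Topology TensorProduct Bundle
open VectorField

namespace KahlerRegularization

noncomputable section

/-! ### The exponential of `i t A` on `V × V = V ⊗ ℂ` -/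

section ComplexExponential

variable {V : Type*} [NormedAddCommGroup V] [NormedSpace ℝ V]

/-- The operator `i A` on the complexification of `V`, realised as the real vector space `V × V`
of pairs (real part, imaginary part); the Banach algebra of its endomorphisms supplies `exp`. -/
def mulI (A : V →L[ℝ] V) : V × V →L[ℝ] V × V :=
  (-(A ∘L ContinuousLinearMap.snd ℝ V V)).prod (A ∘L ContinuousLinearMap.fst ℝ V V)

@[simp]
theorem mulI_apply (A : V →L[ℝ] V) (p : V × V) : mulI A p = (-A p.2, A p.1) := rfl

theorem smul_mulI_pow_apply (A : V →L[ℝ] V) (t : ℝ) (k : ℕ) (a b : V) :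
    ((t • mulI A) ^ k) (a, b) =
      (((Complex.I * t) ^ k).re • (A ^ k) a - ((Complex.I * t) ^ k).im • (A ^ k) b,
        ((Complex.I * t) ^ k).im • (A ^ k) a + ((Complex.I * t) ^ k).re • (A ^ k) b) := by
  induction k with
  | zero => simp
  | succ k ih =>
    rw [pow_succ', mul_apply_eq_comp, ih, pow_succ' (Complex.I * (t : ℂ)),
      pow_succ' A]
    ext <;> simp [smul_smul] <;> module

/-- The complex-linear map `e^{i t A}` on `ℂ ⊗ V`, determined by its real and imaginary parts on
real vectors. -/
def mulIFlow (A : V →L[ℝ] V) (t : ℝ) : ℂ ⊗[ℝ] V →ₗ[ℂ] ℂ ⊗[ℝ] V :=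
  LinearMap.baseChange ℂ
      ((LinearMap.fst ℝ V V) ∘ₗ (NormedSpace.exp (t • mulI A)).toLinearMap ∘ₗ LinearMap.inl ℝ V V) +
    Complex.I • LinearMap.baseChange ℂ
      ((LinearMap.snd ℝ V V) ∘ₗ (NormedSpace.exp (t • mulI A)).toLinearMap ∘ₗ LinearMap.inl ℝ V V)

/-- `e^{i t A}` commutes with multiplication by `i`. -/
theorem exp_mulI_apply_inr (A : V →L[ℝ] V) (t : ℝ) (b : V) :
    NormedSpace.exp (t • mulI A) (0, b) =
      (-(NormedSpace.exp (t • mulI A) (b, 0)).2, (NormedSpace.exp (t • mulI A) (b, 0)).1) := by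
  have hc : Commute (mulI (ContinuousLinearMap.id ℝ V)) (t • mulI A) := by
    ext <;> simp
  have h := DFunLike.congr_fun hc.exp_right.eq (b, 0)
  simpa using h.symm

theorem mulIFlow_apply (A : V →L[ℝ] V) (t : ℝ) (a b : V) :
    mulIFlow A t ((1 : ℂ) ⊗ₜ[ℝ] a + Complex.I ⊗ₜ[ℝ] b) =
      (1 : ℂ) ⊗ₜ[ℝ] (NormedSpace.exp (t • mulI A) (a, b)).1 +
        Complex.I ⊗ₜ[ℝ] (NormedSpace.exp (t • mulI A) (a, b)).2 := by
  have h : NormedSpace.exp (t • mulI A) (a, b) =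
      NormedSpace.exp (t • mulI A) (a, 0) + NormedSpace.exp (t • mulI A) (0, b) := by
    rw [← map_add]; simp
  rw [h, exp_mulI_apply_inr]
  simp only [mulIFlow, LinearMap.add_apply, LinearMap.smul_apply, map_add,
    LinearMap.baseChange_tmul, LinearMap.comp_apply, TensorProduct.smul_tmul',
    LinearMap.inl_apply, LinearMap.fst_apply, LinearMap.snd_apply, Prod.fst_add, Prod.snd_add,
    TensorProduct.tmul_add, smul_eq_mul, Complex.I_mul_I, mul_one, TensorProduct.tmul_neg,
    TensorProduct.neg_tmul, ContinuousLinearMap.coe_coe]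
  abel

variable [CompleteSpace V]

/-- The power series of `e^{i t A} (a + i b)`, written exactly as the Lie series of a complex vector
field: the coefficients are the real and imaginary parts of `(i t)ᵏ / k!`. -/
theorem hasSum_exp_mulI (A : V →L[ℝ] V) (t : ℝ) (a b : V) :
    HasSum (fun k : ℕ => ((Complex.I * t) ^ k / (k.factorial : ℂ)).re • (A ^ k) a
        - ((Complex.I * t) ^ k / (k.factorial : ℂ)).im • (A ^ k) b)
      (NormedSpace.exp (t • mulI A) (a, b)).1 ∧
    HasSum (fun k : ℕ => ((Complex.I * t) ^ k / (k.factorial : ℂ)).im • (A ^ k) a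
        + ((Complex.I * t) ^ k / (k.factorial : ℂ)).re • (A ^ k) b)
      (NormedSpace.exp (t • mulI A) (a, b)).2 := by
  have h := (NormedSpace.exp_series_hasSum_exp' (𝕂 := ℝ) (t • mulI A)).mapL
    (ContinuousLinearMap.apply ℝ (V × V) (a, b))
  have h1 := h.mapL (ContinuousLinearMap.fst ℝ V V)
  have h2 := h.mapL (ContinuousLinearMap.snd ℝ V V)
  have hre (z : ℂ) (k : ℕ) : (z / (k.factorial : ℂ)).re = (k.factorial : ℝ)⁻¹ * z.re := by
    rw [Complex.div_natCast_re]; ring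
  have him (z : ℂ) (k : ℕ) : (z / (k.factorial : ℂ)).im = (k.factorial : ℝ)⁻¹ * z.im := by
    rw [Complex.div_natCast_im]; ring
  constructor
  · convert! h1 using 2 with k
    simp only [ContinuousLinearMap.apply_apply, smul_apply,
      smul_mulI_pow_apply, ContinuousLinearMap.coe_fst', Prod.smul_fst, hre, him, smul_sub,
      smul_smul]
  · convert! h2 using 2 with k
    simp only [ContinuousLinearMap.apply_apply, smul_apply,
      smul_mulI_pow_apply, ContinuousLinearMap.coe_snd', Prod.smul_snd, hre, him, smul_add,
      smul_smul]

theorem exp_mulI_apply_of_eq_zero {A : V →L[ℝ] V} (t : ℝ) {v : V} (hv : A v = 0) :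
    NormedSpace.exp (t • mulI A) (v, 0) = (v, 0) := by
  have h := (NormedSpace.exp_series_hasSum_exp' (𝕂 := ℝ) (t • mulI A)).mapL
    (ContinuousLinearMap.apply ℝ (V × V) (v, 0))
  refine h.unique ?_
  convert hasSum_single 0 ?_ using 1
  · simp
  · intro k hk
    obtain ⟨k, rfl⟩ := Nat.exists_eq_succ_of_ne_zero hk
    have h0 : (t • mulI A) (v, 0) = 0 := by simp [hv]
    simp only [ContinuousLinearMap.apply_apply, smul_apply, pow_succ, mul_apply_eq_comp, h0,
      map_zero, smul_zero]

/-- For a real vector `v`, the form paired on the real and imaginary parts of `e^{i t A} v` is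
`t ↦ t B(v, A v) + o(t)`. -/
theorem hasDerivAt_form_exp_mulI (B : V →L[ℝ] V →L[ℝ] ℝ) (A : V →L[ℝ] V) (v : V) :
    HasDerivAt (fun t : ℝ => B (NormedSpace.exp (t • mulI A) (v, 0)).1
      (NormedSpace.exp (t • mulI A) (v, 0)).2) (B v (A v)) 0 := by
  have h := (hasDerivAt_exp_smul_const (𝕂 := ℝ) (mulI A) 0).clm_apply
    (hasDerivAt_const (0 : ℝ) ((v, 0) : V × V))
  have h1 := (B.hasFDerivAt.comp_hasDerivAt (0 : ℝ) h.fst)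
  have h3 := h1.clm_apply h.snd
  simpa using h3

end ComplexExponential

/-! ### Lagrangian subspaces of the complexification -/

section Lagrangian

variable {V : Type*} [AddCommGroup V] [Module ℝ V]

theorem exists_eq_one_tmul_add_I_tmul (z : ℂ ⊗[ℝ] V) :
    ∃ a b : V, z = (1 : ℂ) ⊗ₜ[ℝ] a + Complex.I ⊗ₜ[ℝ] b := by
  induction z with
  | zero => exact ⟨0, 0, by simp⟩
  | add x y hx hy =>
    obtain ⟨a, b, rfl⟩ := hx
    obtain ⟨c, d, rfl⟩ := hy
    exact ⟨a + c, b + d, by simp only [TensorProduct.tmul_add]; abel⟩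
  | tmul c v =>
    refine ⟨c.re • v, c.im • v, ?_⟩
    rw [← TensorProduct.smul_tmul, ← TensorProduct.smul_tmul, ← TensorProduct.add_tmul]
    congr 1
    simp

theorem one_tmul_ne_zero {v : V} (hv : v ≠ 0) :
    (1 : ℂ) ⊗ₜ[ℝ] v ≠ 0 := by
  intro h
  have := congrArg (fun z => TensorProduct.lid ℝ V (LinearMap.rTensor V Complex.reLm z)) h
  simp at this
  exact hv this

theorem baseChange_complex_nondegenerate {B : LinearMap.BilinForm ℝ V}
    (hB : ∀ v, (∀ w, B v w = 0) → v = 0) (z : ℂ ⊗[ℝ] V)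
    (hz : ∀ w, LinearMap.BilinForm.baseChange ℂ B z w = 0) : z = 0 := by
  obtain ⟨a, b, rfl⟩ := exists_eq_one_tmul_add_I_tmul z
  have h (w : V) : B a w = 0 ∧ B b w = 0 := by
    have := hz ((1 : ℂ) ⊗ₜ w)
    simp only [map_add, LinearMap.add_apply, LinearMap.BilinForm.baseChange_tmul] at this
    simpa [Complex.ext_iff] using this
  rw [hB a fun w => (h w).1, hB b fun w => (h w).2]
  simp

theorem isAlt_baseChange_complex {B : LinearMap.BilinForm ℝ V} (hB : B.IsAlt) :
    (LinearMap.BilinForm.baseChange ℂ B).IsAlt := by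
  intro z
  obtain ⟨a, b, rfl⟩ := exists_eq_one_tmul_add_I_tmul z
  simp only [map_add, LinearMap.add_apply, LinearMap.BilinForm.baseChange_tmul, hB a, hB b,
    ← LinearMap.BilinForm.IsAlt.neg_eq hB a b]
  simp

/-- A subspace of the complexification that equals its own orthogonal complement has half the
dimension. -/
theorem finrank_of_lagrangian [FiniteDimensional ℝ V] {B : LinearMap.BilinForm ℝ V}
    (hB : ∀ v, (∀ w, B v w = 0) → v = 0) (halt : B.IsAlt) (Q : Submodule ℂ (ℂ ⊗[ℝ] V))
    (hQ : ∀ v, v ∈ Q ↔ ∀ w ∈ Q, LinearMap.BilinForm.baseChange ℂ B v w = 0) :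
    2 * Module.finrank ℂ Q = Module.finrank ℝ V := by
  have hC := isAlt_baseChange_complex halt
  have hnd : (LinearMap.BilinForm.baseChange ℂ B).Nondegenerate := by
    exact (LinearMap.IsRefl.nondegenerate_iff_separatingLeft
      (LinearMap.BilinForm.IsAlt.isRefl hC)).2 (baseChange_complex_nondegenerate hB)
  have h := LinearMap.BilinForm.finrank_orthogonal hnd Q
  have hQ' : (LinearMap.BilinForm.baseChange ℂ B).orthogonal Q = Q := by
    ext v
    rw [hQ, LinearMap.BilinForm.mem_orthogonal_iff]
    exact forall₂_congr fun w _ => (LinearMap.BilinForm.IsAlt.isRefl hC).eq_iff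
  rw [hQ', Module.finrank_baseChange] at h
  have := Submodule.finrank_le Q
  rw [Module.finrank_baseChange] at this
  omega

end Lagrangian

/-! ### Calculus at a critical point -/

section Calculus

variable {V : Type*} [NormedAddCommGroup V] [NormedSpace ℝ V]

/-- A product rule in which the operator-valued factor is merely continuous, because the other factor
vanishes at the point. -/
theorem hasFDerivAt_clm_apply_of_eq_zero {X Y : Type*} [NormedAddCommGroup X] [NormedSpace ℝ X]
    [NormedAddCommGroup Y] [NormedSpace ℝ Y] {c : V → X →L[ℝ] Y} {d : V → X} {d' : V →L[ℝ] X}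
    {y : V} (hc : ContinuousAt c y) (hd : HasFDerivAt d d' y) (h0 : d y = 0) :
    HasFDerivAt (fun z => c z (d z)) (c y ∘L d') y := by
  have h1 : HasFDerivAt (fun z => c y (d z)) (c y ∘L d') y := (c y).hasFDerivAt.comp y hd
  have h2 : HasFDerivAt (fun z => (c z - c y) (d z)) (0 : V →L[ℝ] Y) y := by
    have hO : (fun z => ‖c z - c y‖ * ‖d z‖) =o[𝓝 y] fun z => (1 : ℝ) * ‖z - y‖ := by
      refine Asymptotics.IsLittleO.mul_isBigO ?_ ?_
      · rw [Asymptotics.isLittleO_one_iff]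
        simpa using (hc.sub (continuousAt_const (y := c y))).norm.tendsto
      · simpa [h0] using hd.isBigO_sub.norm_norm
    rw [hasFDerivAt_iff_isLittleO]
    refine Asymptotics.IsBigO.trans_isLittleO (g := fun z => ‖c z - c y‖ * ‖d z‖) ?_ ?_
    · refine Asymptotics.IsBigO.of_norm_le fun z => ?_
      simpa [h0] using (c z - c y).le_opNorm (d z)
    · simpa using hO.norm_right
  exact (h2.add h1).congr_of_eventuallyEq (.of_forall fun z => by simp) |>.congr_fderiv (by simp)

/-- If the second derivative along `v` were positive, the point would be a local minimum on that line
as well, so `g` would be constant there. -/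
theorem fderiv_fderiv_apply_self_nonpos_of_isLocalMax {g : V → ℝ} {y : V}
    (hg : ContDiffAt ℝ 2 g y) (hmax : IsLocalMax g y) (v : V) :
    fderiv ℝ (fderiv ℝ g) y v v ≤ 0 := by
  by_contra! hpos
  have hline (s : ℝ) : HasDerivAt (fun s : ℝ => y + s • v) v s := by
    simpa using ((hasDerivAt_id s).smul_const v).const_add y
  have h0 : y + (0 : ℝ) • v = y := by simp
  have hcont : Filter.Tendsto (fun s : ℝ => y + s • v) (𝓝 0) (𝓝 y) := by
    simpa only [h0] using (hline 0).continuousAt.tendsto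
  have hdiff : ∀ᶠ z in 𝓝 y, DifferentiableAt ℝ g z :=
    (hg.eventually (by simp)).mono fun z hz => hz.differentiableAt (by simp)
  have hd1 : deriv (fun s : ℝ => g (y + s • v)) =ᶠ[𝓝 0] fun s => fderiv ℝ g (y + s • v) v := by
    filter_upwards [hcont.eventually hdiff] with s hs
    exact (hs.hasFDerivAt.comp_hasDerivAt s (hline s)).deriv
  have hg' : DifferentiableAt ℝ (fderiv ℝ g) y :=
    (hg.fderiv_right (m := 1) (by norm_num)).differentiableAt (by simp)
  have hg'' : HasFDerivAt (fderiv ℝ g) (fderiv ℝ (fderiv ℝ g) y) (y + (0 : ℝ) • v) := by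
    rw [h0]; exact hg'.hasFDerivAt
  have hd2 : deriv (deriv (fun s : ℝ => g (y + s • v))) 0 = fderiv ℝ (fderiv ℝ g) y v v := by
    rw [hd1.deriv_eq]
    have h1 : HasDerivAt (fun s : ℝ => fderiv ℝ g (y + s • v)) (fderiv ℝ (fderiv ℝ g) y v) 0 :=
      hg''.comp_hasDerivAt (0 : ℝ) (hline 0)
    have h2 := (h1.clm_apply (hasDerivAt_const (0 : ℝ) v)).deriv
    rw [map_zero, add_zero] at h2
    exact h2
  have hmax' : IsLocalMax (fun s : ℝ => g (y + s • v)) 0 := by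
    have h1 : ∀ᶠ z in 𝓝 y, g z ≤ g y := hmax
    filter_upwards [hcont.eventually h1] with s hs
    rwa [h0]
  have hc : ContinuousAt (fun s : ℝ => g (y + s • v)) 0 := by
    refine ContinuousAt.comp ?_ (hline 0).continuousAt
    rw [h0]; exact hg.continuousAt
  have hmin := isLocalMin_of_deriv_deriv_pos (hd2 ▸ hpos) hmax'.deriv_eq_zero hc
  have hconst : (fun s : ℝ => g (y + s • v)) =ᶠ[𝓝 0] fun _ => g (y + (0 : ℝ) • v) := by
    filter_upwards [hmax', hmin] with s h1 h2 using le_antisymm h1 h2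
  have h3 : deriv (deriv (fun s : ℝ => g (y + s • v))) 0 = 0 := by
    rw [hconst.deriv.deriv_eq]; simp
  linarith

/-- An isotropic vector of a negative semidefinite symmetric form lies in its kernel. -/
theorem clm_apply_eq_zero_of_nonpos {B : V →L[ℝ] V →L[ℝ] ℝ} (hsymm : ∀ u v, B u v = B v u)
    (hB : ∀ v, B v v ≤ 0) {v : V} (hv : B v v = 0) (w : V) : B v w = 0 := by
  by_contra hne
  have h (s : ℝ) : 2 * s * B v w + B w w ≤ 0 := by
    have h1 := hB (s • v + w)
    simp only [map_add, map_smul, add_apply, smul_apply, hv, hsymm w v, smul_eq_mul] at h1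
    linarith
  -- at this `s` the left-hand side of `h s` equals `1`
  have h2 := h ((1 - B w w) / (2 * B v w))
  have h3 : 2 * ((1 - B w w) / (2 * B v w)) * B v w = 1 - B w w := by field_simp
  linarith

end Calculus

/-! ### Hamiltonian vector fields in a chart -/

section Geometry

variable {E : Type*} [NormedAddCommGroup E] [NormedSpace ℝ E]
variable {M : Type*} [TopologicalSpace M] [ChartedSpace E M]

/-- The derivative at `y` of the inverse of the preferred chart at `x`, as an endomorphism of the
model space, to which every tangent space is definitionally equal. -/
def chartFrame (x : M) (y : E) : E →L[ℝ] E :=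
  mfderivWithin 𝓘(ℝ, E) 𝓘(ℝ, E) (extChartAt 𝓘(ℝ, E) x).symm (Set.range 𝓘(ℝ, E)) y

/-- The vector field `V` in the preferred chart at `x`. -/
def chartVF (V : ∀ z : M, TangentSpace 𝓘(ℝ, E) z) (x : M) (y : E) : E :=
  (chartFrame x y).inverse (V ((extChartAt 𝓘(ℝ, E) x).symm y))

theorem chartVF_self (V : ∀ z : M, TangentSpace 𝓘(ℝ, E) z) (x : M) :
    chartVF V x (extChartAt 𝓘(ℝ, E) x x) =
      (chartFrame x (extChartAt 𝓘(ℝ, E) x x)).inverse (V x) := by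
  have h : (V ((extChartAt 𝓘(ℝ, E) x).symm (extChartAt 𝓘(ℝ, E) x x)) : E) = V x :=
    congrArg (fun z => (V z : E)) (extChartAt_to_inv x)
  exact congrArg _ h

theorem isLocalMax_comp_extChartAt_symm {h : M → ℝ} {x : M} (hmax : IsLocalMax h x) :
    IsLocalMax (h ∘ (extChartAt 𝓘(ℝ, E) x).symm) (extChartAt 𝓘(ℝ, E) x x) := by
  have h1 : Filter.Tendsto (extChartAt 𝓘(ℝ, E) x).symm (𝓝 (extChartAt 𝓘(ℝ, E) x x)) (𝓝 x) := by
    have := (continuousAt_extChartAt_symm (I := 𝓘(ℝ, E)) x).tendsto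
    rwa [extChartAt_to_inv] at this
  have h2 : ∀ᶠ z in 𝓝 x, h z ≤ h x := hmax
  filter_upwards [h1.eventually h2] with y hy
  rwa [Function.comp_apply, Function.comp_apply, extChartAt_to_inv]

variable [IsManifold 𝓘(ℝ, E) ω M]

/-- The symplectic form at `x`, viewed on the model space. -/
def formAt (S : AnalyticSymplecticForm E M) (x : M) : E →L[ℝ] E →L[ℝ] ℝ := S.form x

/-- The symplectic form in the preferred chart at `x`. -/
def chartForm (S : AnalyticSymplecticForm E M) (x : M) (y : E) : E →L[ℝ] E →L[ℝ] ℝ :=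
  (formAt S ((extChartAt 𝓘(ℝ, E) x).symm y)).bilinearComp (chartFrame x y) (chartFrame x y)

theorem isInvertible_chartFrame {x : M} {y : E} (hy : y ∈ (extChartAt 𝓘(ℝ, E) x).target) :
    (chartFrame x y).IsInvertible := by
  have : IsManifold 𝓘(ℝ, E) 1 M := IsManifold.of_le (n := ω) le_top
  exact isInvertible_mfderivWithin_extChartAt_symm hy

theorem inverse_mfderiv_extChartAt (x : M) :
    ((mfderiv 𝓘(ℝ, E) 𝓘(ℝ, E) (extChartAt 𝓘(ℝ, E) x) x).inverse : E →L[ℝ] E) =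
      chartFrame x (extChartAt 𝓘(ℝ, E) x x) := by
  have : IsManifold 𝓘(ℝ, E) 1 M := IsManifold.of_le (n := ω) le_top
  exact ContinuousLinearMap.inverse_eq
    (mfderiv_extChartAt_comp_mfderivWithin_extChartAt_symm' (mem_extChartAt_source x))
    (mfderivWithin_extChartAt_symm_comp_mfderiv_extChartAt' (mem_extChartAt_source x))

theorem mlieBracket_eq_chart (V W : ∀ z : M, TangentSpace 𝓘(ℝ, E) z) (x : M) :
    (mlieBracket 𝓘(ℝ, E) V W x : E) = chartFrame x (extChartAt 𝓘(ℝ, E) x x)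
      (lieBracket ℝ (chartVF V x) (chartVF W x) (extChartAt 𝓘(ℝ, E) x x)) := by
  rw [← inverse_mfderiv_extChartAt, ← lieBracketWithin_univ]
  have : (extChartAt 𝓘(ℝ, E) x).symm ⁻¹' Set.univ ∩ Set.range 𝓘(ℝ, E) = Set.univ := by simp
  rw [← this]
  rfl

variable [FiniteDimensional ℝ E]

/-- In finite dimension it suffices to evaluate on two fixed vectors, which the trivialization of the
tangent bundle at `x` turns into local sections. -/
theorem continuousAt_chartForm (S : AnalyticSymplecticForm E M) (x : M) :
    ContinuousAt (chartForm S x) (extChartAt 𝓘(ℝ, E) x x) := by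
  have : IsManifold 𝓘(ℝ, E) 1 M := IsManifold.of_le (n := ω) le_top
  rw [continuousAt_clm_apply]
  intro u
  rw [continuousAt_clm_apply]
  intro w
  set e := trivializationAt E (TangentSpace 𝓘(ℝ, E) : M → Type _) x
  have hx : x ∈ e.baseSet := FiberBundle.mem_baseSet_trivializationAt' x
  have hsec (u : E) : ContMDiffAt 𝓘(ℝ, E) (𝓘(ℝ, E).prod 𝓘(ℝ, E)) 0
      (fun z : M => Bundle.TotalSpace.mk' E z (e.symmL ℝ z u)) x := by
    rw [Bundle.contMDiffAt_totalSpace]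
    refine ⟨contMDiffAt_id, (contMDiffAt_const (c := u)).congr_of_eventuallyEq ?_⟩
    filter_upwards [e.open_baseSet.mem_nhds hx] with z hz
    have h1 := e.continuousLinearMapAt_symmL (R := ℝ) hz u
    rwa [Bundle.Trivialization.continuousLinearMapAt_apply_of_mem ℝ e hz] at h1
  have h3 : ContMDiffAt 𝓘(ℝ, E) (𝓘(ℝ, E).prod 𝓘(ℝ, ℝ)) 0
      (fun z => Bundle.TotalSpace.mk' ℝ (E := Bundle.Trivial M ℝ) z
        (S.form z (e.symmL ℝ z u) (e.symmL ℝ z w))) x := by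
    apply ContMDiffAt.clm_bundle_apply₂ (F₁ := E) (F₂ := E)
    · exact (S.analytic x).of_le (by simp)
    · exact hsec u
    · exact hsec w
  rw [Bundle.contMDiffAt_totalSpace] at h3
  have h4 : ContinuousAt (fun z => S.form z (e.symmL ℝ z u) (e.symmL ℝ z w)) x := h3.2.continuousAt
  have h5 : ContinuousAt (extChartAt 𝓘(ℝ, E) x).symm (extChartAt 𝓘(ℝ, E) x x) :=
    continuousAt_extChartAt_symm x
  have h6 := ContinuousAt.comp (x := extChartAt 𝓘(ℝ, E) x x)
    (by simpa only [extChartAt_to_inv] using h4) h5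
  refine h6.congr ?_
  filter_upwards [extChartAt_target_mem_nhds (I := 𝓘(ℝ, E)) x] with y hy
  have hy' := (extChartAt 𝓘(ℝ, E) x).map_target hy
  have hframe : ((trivializationAt E (TangentSpace 𝓘(ℝ, E) : M → Type _) x).symmL ℝ
      ((extChartAt 𝓘(ℝ, E) x).symm y) : E →L[ℝ] E) = chartFrame x y := by
    rw [extChartAt_source] at hy'
    refine (TangentBundle.symmL_trivializationAt hy').trans ?_
    exact congrArg (chartFrame x) ((extChartAt 𝓘(ℝ, E) x).right_inv hy)
  have happ (u : E) : ((trivializationAt E (TangentSpace 𝓘(ℝ, E) : M → Type _) x).symmL ℝ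
      ((extChartAt 𝓘(ℝ, E) x).symm y) u : E) = chartFrame x y u := DFunLike.congr_fun hframe u
  exact congrArg₂ (fun a b : E => formAt S ((extChartAt 𝓘(ℝ, E) x).symm y) a b) (happ u) (happ w)

theorem isInvertible_of_nondegenerate {B : E →L[ℝ] E →L[ℝ] ℝ}
    (hB : ∀ v, (∀ w, B v w = 0) → v = 0) : B.IsInvertible := by
  have hinj : Function.Injective B.toLinearMap :=
    (injective_iff_map_eq_zero _).2 fun v hv => hB v fun w => DFunLike.congr_fun hv w
  have hdim : Module.finrank ℝ E = Module.finrank ℝ (E →L[ℝ] ℝ) := by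
    rw [← (LinearMap.toContinuousLinearMap (𝕜 := ℝ) (E := E) (F' := ℝ)).finrank_eq]
    exact Subspace.dual_finrank_eq.symm
  exact ⟨(LinearMap.linearEquivOfInjective B.toLinearMap hinj hdim).toContinuousLinearEquiv,
    by ext; rfl⟩

theorem isInvertible_chartForm (S : AnalyticSymplecticForm E M) {x : M} {y : E}
    (hy : y ∈ (extChartAt 𝓘(ℝ, E) x).target) : (chartForm S x y).IsInvertible := by
  obtain ⟨P, hP⟩ := isInvertible_chartFrame hy
  refine isInvertible_of_nondegenerate fun v hv => ?_
  have h : chartFrame x y v = 0 := by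
    refine S.nondegenerate ((extChartAt 𝓘(ℝ, E) x).symm y) _ fun w => ?_
    have h1 := hv (P.symm w)
    have h2 : chartFrame x y (P.symm w) = w := by rw [← hP]; exact P.apply_symm_apply w
    have h3 : formAt S ((extChartAt 𝓘(ℝ, E) x).symm y) (chartFrame x y v)
      (chartFrame x y (P.symm w)) = 0 := h1
    rw [h2] at h3
    exact h3
  rw [← hP] at h
  simpa using h

/-- Hamilton's equation `ω(X_h, ·) = dh` in the chart. -/
theorem chartForm_chartVF_hamVF (S : AnalyticSymplecticForm E M) {h : M → ℝ}
    (hh : ContMDiff 𝓘(ℝ, E) 𝓘(ℝ, ℝ) ω h) {x : M} {y : E}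
    (hy : y ∈ (extChartAt 𝓘(ℝ, E) x).target) :
    chartForm S x y (chartVF (S.hamVF h) x y) =
      fderiv ℝ (h ∘ (extChartAt 𝓘(ℝ, E) x).symm) y := by
  have : IsManifold 𝓘(ℝ, E) 1 M := IsManifold.of_le (n := ω) le_top
  obtain ⟨P, hP⟩ := isInvertible_chartFrame hy
  ext w
  have h1 : chartFrame x y (chartVF (S.hamVF h) x y) =
      S.hamVF h ((extChartAt 𝓘(ℝ, E) x).symm y) := by
    rw [chartVF, ← hP, ContinuousLinearMap.inverse_equiv]
    exact P.apply_symm_apply _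
  change formAt S _ (chartFrame x y (chartVF (S.hamVF h) x y)) (chartFrame x y w) = _
  rw [h1]
  refine (S.form_hamVF h _ (chartFrame x y w)).trans ?_
  have h2 : mfderivWithin 𝓘(ℝ, E) 𝓘(ℝ, ℝ) (h ∘ (extChartAt 𝓘(ℝ, E) x).symm)
      (Set.range 𝓘(ℝ, E)) y = _ :=
    mfderiv_comp_mfderivWithin y ((hh.mdifferentiable (by simp)) _)
      (mdifferentiableWithinAt_extChartAt_symm hy)
      (by simp [uniqueMDiffWithinAt_univ])
  have h3 : fderiv ℝ (h ∘ (extChartAt 𝓘(ℝ, E) x).symm) y = mfderivWithin 𝓘(ℝ, E) 𝓘(ℝ, ℝ)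
      (h ∘ (extChartAt 𝓘(ℝ, E) x).symm) (Set.range 𝓘(ℝ, E)) y := by
    rw [← mfderiv_eq_fderiv, ← mfderivWithin_univ, modelWithCornersSelf_coe, Set.range_id]
  exact (DFunLike.congr_fun (h3.trans h2) w).symm

theorem chartVF_hamVF_eq_zero_of_isLocalMax (S : AnalyticSymplecticForm E M) {h : M → ℝ}
    (hh : ContMDiff 𝓘(ℝ, E) 𝓘(ℝ, ℝ) ω h) {x : M} (hmax : IsLocalMax h x) :
    chartVF (S.hamVF h) x (extChartAt 𝓘(ℝ, E) x x) = 0 := by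
  have hy := mem_extChartAt_target (I := 𝓘(ℝ, E)) x
  have h1 := chartForm_chartVF_hamVF S hh hy
  rw [(isLocalMax_comp_extChartAt_symm hmax).fderiv_eq_zero] at h1
  obtain ⟨e, he⟩ := isInvertible_chartForm S hy
  rw [← he] at h1
  simpa using h1

/-- At a local maximum `x` of `h` the field `X_h` vanishes, so that `L_{X_h}` acts on values at `x`
by a linear map `A`, minus the linearization of `X_h`. Differentiating Hamilton's equation gives
`ω(v, A v) = Hess h (v, v)`, whence the sign of `ω(v, A v)` and the equality case. -/
theorem exists_linearization_of_isLocalMax (S : AnalyticSymplecticForm E M) {h : M → ℝ}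
    (hh : ContMDiff 𝓘(ℝ, E) 𝓘(ℝ, ℝ) ω h) {x : M} (hmax : IsLocalMax h x) :
    ∃ A : E →L[ℝ] E, (∀ Y : ∀ z : M, TangentSpace 𝓘(ℝ, E) z,
      (mlieBracket 𝓘(ℝ, E) (S.hamVF h) Y x : E) = A (Y x)) ∧
      (∀ v, formAt S x v (A v) ≤ 0) ∧ ∀ v, formAt S x v (A v) = 0 → A v = 0 := by
  set φ := extChartAt 𝓘(ℝ, E) x
  have hy : φ x ∈ φ.target := mem_extChartAt_target x
  set g : E → ℝ := h ∘ φ.symm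
  set D := chartFrame x (φ x) with hD
  set B := chartForm S x (φ x) with hB
  obtain ⟨P, hP⟩ := isInvertible_chartFrame hy
  have hBinv := isInvertible_chartForm S hy
  have hBapp (u w : E) : B u w = formAt S x (D u) (D w) := by
    have h1 : formAt S (φ.symm (φ x)) = formAt S x := congrArg (formAt S) (extChartAt_to_inv x)
    rw [← h1]
    rfl
  have hg : ContDiffAt ℝ 2 g (φ x) := by
    have h1 : ContMDiffAt 𝓘(ℝ, E) 𝓘(ℝ, E) ω φ.symm (φ x) :=
      (contMDiffOn_extChartAt_symm x).contMDiffAt (extChartAt_target_mem_nhds x)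
    exact ((hh.contMDiffAt.comp (φ x) h1).contDiffAt).of_le le_top
  have hgmax : IsLocalMax g (φ x) := isLocalMax_comp_extChartAt_symm hmax
  have hdg : HasFDerivAt (fderiv ℝ g) (fderiv ℝ (fderiv ℝ g) (φ x)) (φ x) :=
    ((hg.fderiv_right (m := 1) (by norm_num)).differentiableAt (by simp)).hasFDerivAt
  have hVF : HasFDerivAt (chartVF (S.hamVF h) x) (B.inverse ∘L fderiv ℝ (fderiv ℝ g) (φ x))
      (φ x) := by
    have hc : ContinuousAt (fun y => (chartForm S x y).inverse) (φ x) :=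
      ContinuousAt.comp (hBinv.contDiffAt_map_inverse (n := 0)).continuousAt
        (continuousAt_chartForm S x)
    refine (hasFDerivAt_clm_apply_of_eq_zero hc hdg hgmax.fderiv_eq_zero).congr_of_eventuallyEq ?_
    filter_upwards [extChartAt_target_mem_nhds (I := 𝓘(ℝ, E)) x] with y hy
    rw [← chartForm_chartVF_hamVF S hh hy]
    obtain ⟨e, he⟩ := isInvertible_chartForm S hy
    rw [← he]
    simp
  set A₀ := B.inverse ∘L fderiv ℝ (fderiv ℝ g) (φ x)
  have hBA (u w : E) : B (A₀ u) w = fderiv ℝ (fderiv ℝ g) (φ x) u w := by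
    obtain ⟨e, he⟩ := hBinv
    simp only [A₀, ContinuousLinearMap.comp_apply]
    rw [← hB] at he
    rw [← he]
    simp
  have hkey (v : E) : formAt S x v (-(D (A₀ (D.inverse v)))) =
      fderiv ℝ (fderiv ℝ g) (φ x) (D.inverse v) (D.inverse v) := by
    rw [← hBA, hBapp]
    have h1 : D (D.inverse v) = v := by rw [hD, ← hP]; simp
    rw [h1, map_neg]
    have halt (u w : E) : - formAt S x u w = formAt S x w u :=
      LinearMap.BilinForm.IsAlt.neg_eq (B₁ := S.bilin x) (S.alternating x) u w
    exact halt _ _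
  refine ⟨-(D ∘L A₀ ∘L D.inverse), fun Y => ?_, fun v => ?_, fun v hv => ?_⟩
  · rw [mlieBracket_eq_chart, lieBracket, hVF.fderiv]
    have h0 : chartVF (S.hamVF h) x (φ x) = 0 := chartVF_hamVF_eq_zero_of_isLocalMax S hh hmax
    rw [h0, chartVF_self, map_zero, zero_sub, map_neg]
    rfl
  · exact (hkey v).trans_le (fderiv_fderiv_apply_self_nonpos_of_isLocalMax hg hgmax _)
  · have h1 : ∀ w, fderiv ℝ (fderiv ℝ g) (φ x) (D.inverse v) w = 0 := by
      refine clm_apply_eq_zero_of_nonpos ?_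
        (fun v => fderiv_fderiv_apply_self_nonpos_of_isLocalMax hg hgmax v)
        ((hkey v).symm.trans hv)
      exact hg.isSymmSndFDerivAt (by simp)
    have h2 : A₀ (D.inverse v) = 0 := by
      have : fderiv ℝ (fderiv ℝ g) (φ x) (D.inverse v) = 0 := by ext w; exact h1 w
      simp [A₀, this]
    simp [h2]

end Geometry

/-! ### The polarization at a point where the Hamiltonian vector field vanishes -/

section Polarization

variable {E : Type*} [NormedAddCommGroup E] [NormedSpace ℝ E]
variable {M : Type*} [TopologicalSpace M] [ChartedSpace E M]

theorem iterate_lieDeriv_apply {X : ∀ z : M, TangentSpace 𝓘(ℝ, E) z} {x : M} {A : E →L[ℝ] E}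
    (hA : ∀ Y : ∀ z : M, TangentSpace 𝓘(ℝ, E) z, (mlieBracket 𝓘(ℝ, E) X Y x : E) = A (Y x))
    (Y : ComplexVectorField E M) (k : ℕ) :
    (((ComplexVectorField.lieDeriv X)^[k] Y).re x : E) = (A ^ k) (Y.re x) ∧
      (((ComplexVectorField.lieDeriv X)^[k] Y).im x : E) = (A ^ k) (Y.im x) := by
  induction k with
  | zero => exact ⟨rfl, rfl⟩
  | succ k ih =>
    rw [Function.iterate_succ_apply', pow_succ']
    exact ⟨(hA _).trans (congrArg A ih.1), (hA _).trans (congrArg A ih.2)⟩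

/-- `e^{i t A}` on the complexified tangent space at `x`. -/
def tangentFlow (A : E →L[ℝ] E) (t : ℝ) (x : M) :
    CTangent (E := E) x →ₗ[ℂ] CTangent (E := E) x :=
  mulIFlow (V := E) A t

/-- The real and imaginary parts of `e^{i t A} (a + i b)`, as tangent vectors at `x`. -/
def tangentExp (A : E →L[ℝ] E) (t : ℝ) (x : M) (a b : TangentSpace 𝓘(ℝ, E) x) :
    TangentSpace 𝓘(ℝ, E) x × TangentSpace 𝓘(ℝ, E) x :=
  NormedSpace.exp (t • mulI A) ((a, b) : E × E)

theorem tangentFlow_toCTangent (A : E →L[ℝ] E) (t : ℝ) (x : M)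
    (a b : TangentSpace 𝓘(ℝ, E) x) :
    tangentFlow A t x (toCTangent a b) =
      toCTangent (tangentExp A t x a b).1 (tangentExp A t x a b).2 :=
  mulIFlow_apply (V := E) A t a b

/-- If `L_X` acts on values at `x` by the linear map `A`, the value at `x` of a convergent Lie series
is `e^{i t A}` of the initial value; no regularity of the fields is involved. -/
theorem val_eq_tangentFlow_of_isLieExpAt [CompleteSpace E]
    {X : ∀ z : M, TangentSpace 𝓘(ℝ, E) z} {x : M} {A : E →L[ℝ] E}
    (hA : ∀ Y : ∀ z : M, TangentSpace 𝓘(ℝ, E) z, (mlieBracket 𝓘(ℝ, E) X Y x : E) = A (Y x))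
    {Y Z : ComplexVectorField E M} {t : ℝ}
    (h : ComplexVectorField.IsLieExpAt X (Complex.I * t) Y Z x) :
    Z.val x = tangentFlow A t x (Y.val x) := by
  have hs := hasSum_exp_mulI A t (Y.re x) (Y.im x)
  have h1 : Z.re x = (tangentExp A t x (Y.re x) (Y.im x)).1 := by
    refine HasSum.unique (α := E) h.1 (hs.1.congr_fun ?_)
    intro k
    rw [← (iterate_lieDeriv_apply hA Y k).1, ← (iterate_lieDeriv_apply hA Y k).2]
    rfl
  have h2 : Z.im x = (tangentExp A t x (Y.re x) (Y.im x)).2 := by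
    refine HasSum.unique (α := E) h.2 (hs.2.congr_fun ?_)
    intro k
    rw [← (iterate_lieDeriv_apply hA Y k).1, ← (iterate_lieDeriv_apply hA Y k).2]
    rfl
  rw [ComplexVectorField.val, ComplexVectorField.val, tangentFlow_toCTangent, h1, h2]

variable [IsManifold 𝓘(ℝ, E) ω M]

theorem complexTimeImage_le_map [CompleteSpace E] {X : ∀ z : M, TangentSpace 𝓘(ℝ, E) z} {x : M}
    {A : E →L[ℝ] E}
    (hA : ∀ Y : ∀ z : M, TangentSpace 𝓘(ℝ, E) z, (mlieBracket 𝓘(ℝ, E) X Y x : E) = A (Y x))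
    (Q : ∀ z : M, Submodule ℂ (CTangent (E := E) z)) (t : ℝ) :
    complexTimeImage X (Complex.I * t) Q x ≤ (Q x).map (tangentFlow A t x) := by
  refine Submodule.span_le.2 ?_
  rintro z ⟨Y, Z, -, hY, -, hexp, rfl⟩
  exact ⟨Y.val x, hY.self_of_nhds, (val_eq_tangentFlow_of_isLieExpAt hA hexp.self_of_nhds).symm⟩

theorem re_I_mul_formC_conjC (S : AnalyticSymplecticForm E M) (x : M)
    (a b : TangentSpace 𝓘(ℝ, E) x) :
    (Complex.I * S.formC x (toCTangent a b) (conjC x (toCTangent a b))).re = 2 * S.form x a b := by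
  have halt (u w : TangentSpace 𝓘(ℝ, E) x) : -S.bilin x u w = S.bilin x w u :=
      LinearMap.BilinForm.IsAlt.neg_eq (B₁ := S.bilin x) (S.alternating x) u w
  have h0 (u : TangentSpace 𝓘(ℝ, E) x) : S.bilin x u u = 0 := S.alternating x u
  simp only [AnalyticSymplecticForm.formC, toCTangent, conjC, map_add, LinearMap.rTensor_tmul,
    LinearMap.add_apply, LinearMap.BilinForm.baseChange_tmul, h0, ← halt a b]
  simp
  change _ = 2 * S.bilin x a b
  ring

variable [FiniteDimensional ℝ E]

theorem finrank_realPolarization_le (S : AnalyticSymplecticForm E M) {n : ℕ}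
    (H : Fin n → M → ℝ) (x : M) : Module.finrank ℂ (S.realPolarization H x) ≤ n :=
  (finrank_range_le_card (R := ℂ) (fun j => toCTangent (S.hamVF (H j) x) 0)).trans_eq
    (Fintype.card_fin n)

/-- The inclusion of the fibre of the Kähler polarization into `e^{i t A} P_x` is an equality
because the fibre has dimension `n` and `P_x` is spanned by `n` vectors; in particular `P_x` has full rank. -/
theorem complexTimeImage_eq_map (S : AnalyticSymplecticForm E M) {n : ℕ}
    (hdim : Module.finrank ℝ E = 2 * n) (H : Fin n → M → ℝ)
    {X : ∀ z : M, TangentSpace 𝓘(ℝ, E) z} {x : M} {A : E →L[ℝ] E}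
    (hA : ∀ Y : ∀ z : M, TangentSpace 𝓘(ℝ, E) z, (mlieBracket 𝓘(ℝ, E) X Y x : E) = A (Y x))
    {t : ℝ} (hK : S.IsKahlerPolarization
      (complexTimeImage X (Complex.I * t) (S.realPolarization H))) :
    complexTimeImage X (Complex.I * t) (S.realPolarization H) x =
      (S.realPolarization H x).map (tangentFlow A t x) ∧
    Module.finrank ℂ (S.realPolarization H x) = n := by
  have hle := complexTimeImage_le_map hA (S.realPolarization H) t
  have hfin : 2 * Module.finrank ℂ
      (complexTimeImage X (Complex.I * t) (S.realPolarization H) x) = 2 * n :=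
    hdim ▸ finrank_of_lagrangian (B := S.bilin x) (S.nondegenerate x) (S.alternating x)
    _ (hK.lagrangian x)
  have hP := finrank_realPolarization_le S H x
  have hmap : Module.finrank ℂ ((S.realPolarization H x).map (tangentFlow A t x)) ≤
    Module.finrank ℂ (S.realPolarization H x) := Submodule.finrank_map_le _ _
  have hmono := Submodule.finrank_mono hle
  exact ⟨Submodule.eq_of_le_of_finrank_le hle (by omega), by omega⟩

end Polarization

end

end KahlerRegularization

open KahlerRegularization in
theorem theorem3p3 {E : Type*} [NormedAddCommGroup E] [NormedSpace ℝ E] [FiniteDimensional ℝ E]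
    {M : Type*} [TopologicalSpace M] [ChartedSpace E M] [IsManifold 𝓘(ℝ, E) ω M]
    [CompactSpace M] [T2Space M] [Nonempty M]
    (n : ℕ) (hn : 0 < n) (hdim : Module.finrank ℝ E = 2 * n)
    (S : AnalyticSymplecticForm E M) (H : Fin n → M → ℝ)
    (hH : ∀ j, ContMDiff 𝓘(ℝ, E) 𝓘(ℝ, ℝ) ω (H j))
    (hpoisson : ∀ j k x, S.poisson (H j) (H k) x = 0)
    (hregular : ∃ U : Set M, IsOpen U ∧ Dense U ∧
      ∀ x ∈ U, LinearIndependent ℝ (fun j => mvfderiv 𝓘(ℝ, E) (H j) x)) :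
    ¬ ∃ h : M → ℝ, ContMDiff 𝓘(ℝ, E) 𝓘(ℝ, ℝ) ω h ∧
      S.IsRegulatorOfFirstType (S.realPolarization H) h := by
  rintro ⟨h, hh, T, hT, hK⟩
  have : CompleteSpace E := FiniteDimensional.complete ℝ E
  obtain ⟨x, -, hx⟩ := isCompact_univ.exists_isMaxOn Set.univ_nonempty hh.continuous.continuousOn
  have hmax : IsLocalMax h x := hx.isLocalMax Filter.univ_mem
  obtain ⟨A, hA, hA1, hA2⟩ := exists_linearization_of_isLocalMax S hh hmax
  have hrank := (complexTimeImage_eq_map S hdim H hA (hK (T / 2) (by linarith) (by linarith))).2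
  obtain ⟨j, hj⟩ : ∃ j, S.hamVF (H j) x ≠ 0 := by
    by_contra! h0
    have : S.realPolarization H x = ⊥ := by
      simp [AnalyticSymplecticForm.realPolarization, h0, toCTangent]
    rw [this, finrank_bot] at hrank
    omega
  set v : TangentSpace 𝓘(ℝ, E) x := S.hamVF (H j) x
  have hpos (t : ℝ) (h0 : 0 < t) (h1 : t < T)
      (hne : toCTangent (tangentExp A t x v 0).1 (tangentExp A t x v 0).2 ≠ 0) :
      0 < S.form x (tangentExp A t x v 0).1 (tangentExp A t x v 0).2 := by
    have hmem : toCTangent (tangentExp A t x v 0).1 (tangentExp A t x v 0).2 ∈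
        complexTimeImage (S.hamVF h) (Complex.I * t) (S.realPolarization H) x := by
      rw [(complexTimeImage_eq_map S hdim H hA (hK t h0 h1)).1, ← tangentFlow_toCTangent]
      exact Submodule.mem_map_of_mem (Submodule.subset_span ⟨j, rfl⟩)
    have h2 := (hK t h0 h1).positive x _ hmem hne
    rw [re_I_mul_formC_conjC] at h2
    exact pos_of_mul_pos_right h2 two_pos.le
  -- positivity for small `t > 0` forces the derivative at `t = 0` to be nonnegative
  have hnonneg : 0 ≤ formAt S x v (A v) := by
    refine ge_of_tendsto (hasDerivAt_form_exp_mulI (formAt S x) A v).tendsto_slope_zero_right ?_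
    filter_upwards [Ioo_mem_nhdsGT hT] with t ht
    have h0 : formAt S x (NormedSpace.exp ((0 : ℝ) • mulI A) (v, 0)).1
        (NormedSpace.exp ((0 : ℝ) • mulI A) (v, 0)).2 = 0 := by
      rw [zero_smul, NormedSpace.exp_zero]
      exact map_zero _
    rw [h0, sub_zero, zero_add]
    refine smul_nonneg (inv_nonneg.2 ht.1.le) ?_
    change 0 ≤ S.form x (tangentExp A t x v 0).1 (tangentExp A t x v 0).2
    by_cases hne : toCTangent (tangentExp A t x v 0).1 (tangentExp A t x v 0).2 = 0
    · have h2 := re_I_mul_formC_conjC S x (tangentExp A t x v 0).1 (tangentExp A t x v 0).2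
      rw [hne, map_zero, map_zero, LinearMap.zero_apply, mul_zero, Complex.zero_re] at h2
      linarith
    · exact (hpos t ht.1 ht.2 hne).le
  have hAv : A v = 0 := hA2 v (le_antisymm (hA1 v) hnonneg)
  -- now `e^{i t A}` fixes the real vector `v`, and real vectors are not positive
  have hfix : tangentExp A (T / 2) x v 0 = (v, 0) := exp_mulI_apply_of_eq_zero (T / 2) hAv
  have h2 := hpos (T / 2) (by linarith) (by linarith)
  rw [hfix] at h2
  refine (h2 ?_).ne' (map_zero _)
  rw [toCTangent, TensorProduct.tmul_zero, add_zero]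
  exact one_tmul_ne_zero hj
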